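/- For complex numbers $a,q$ with $|q|<1$ and an integer $n\ge 0$ write $(a;q)_n=\prod_{k=0}^{n-1}(1-aq^k)$ and $(a;q)_\infty=\prod_{k=0}^{\infty}(1-aq^k)$. Let $q\in\mathbb{C}$ with $|q|<1$. Then all series below converge, and (1) $$\sum_{n=0}^{\infty}\frac{(-q;q^2)_n\,q^{n^2}}{(1-q^{2n+1})\,(q^2;q^2)_n^2}=\frac{(-q;q^2)_\infty}{(q^2;q^2)_\infty}\left(1+\sum_{r=0}^\infty q^{8r^2+4r+1}(1-q^{8r+4})\right),$$ (2) $$\sum_{n=0}^{\infty}\frac{q^{n^2+n}}{(1-q^{2n+1})\,(q;q)_n^2}=\frac{1}{(q;q)_\infty}\sum_{r=0}^\infty q^{6r^2+2r}(1-q^{8r+4}),$$ (3) $$\sum_{n=0}^{\infty}\frac{q^{n^2+2n}}{(1-q^{2n+1})\,(q;q)_n^2}=\frac{1}{(q;q)_\infty}\sum_{r=0}^\infty q^{6r^2+4r}(1-q^{4r+2}),$$ (4) $$\sum_{n=0}^{\infty}\frac{(-q;q)_n\,q^{(n^2+n)/2}}{(1-q^{2n+1})\,(q;q)_n^2}=\frac{(-q;q)_\infty}{(q;q)_\infty}\sum_{r=0}^\infty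 q^{4r^2+r}(1-q^{6r+3}),$$ (5) $$\sum_{n=0}^{\infty}\frac{(-q;q)_n\,q^{(n^2+3n)/2}}{(1-q^{2n+1})\,(q;q)_n^2}=\frac{(-q;q)_\infty}{(q;q)_\infty}\sum_{r=0}^\infty q^{4r^2+3r}(1-q^{2r+1}),$$ (6) $$\sum_{n=0}^{\infty}\frac{q^{n^2+2n}}{(1-q^{2n+1})\,(q^2;q^2)_n}=(-q;q^2)_\infty\sum_{r=0}^\infty(-1)^r q^{6r^2+4r}(1+q^{4r+2}),$$ and, if moreover $q\neq 0$, (7) $$\sum_{n=0}^{\infty}\frac{(-q;q^2)_{n+1}\,q^{n^2-2n}}{(q^2;q^2)_n\,(q^2;q^2)_{n+1}}=\frac{(-q;q^2)_\infty}{(q^2;q^2)_\infty}\left[1+q+q^2+q^3+\sum_{r=0}^\infty q^{r^2}\left(q^{-2r}-q^{2r}\right)\right].$$ -/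

import Mathlib

/-- The finite `q`-shifted factorial `(a;q)_n = (1-a)(1-aq)⋯(1-aq^{n-1})`. -/
noncomputable def qPoch (a q : ℂ) (n : ℕ) : ℂ :=
  ∏ k ∈ Finset.range n, (1 - a * q ^ k)

/-- The infinite `q`-shifted factorial `(a;q)_∞ = (1-a)(1-aq)(1-aq^2)⋯`, for `|q| < 1`. -/
noncomputable def qPochInf (a q : ℂ) : ℂ :=
  ∏' k : ℕ, (1 - a * q ^ k)

/-- The infinite product defining `(a;q)_∞` converges for `|q| < 1`. -/
theorem multipliable_qPochInf (a q : ℂ) (hq : ‖q‖ < 1) :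
    Multipliable fun k : ℕ => 1 - a * q ^ k := by
  have h : Summable fun k : ℕ => ‖-(a * q ^ k)‖ := by
    simp only [norm_neg, norm_mul, norm_pow]
    exact (summable_geometric_of_lt_one (norm_nonneg q) hq).mul_left _
  simpa only [sub_eq_add_neg] using multipliable_one_add_of_summable h

/-!
A Bailey pair relative to `a` is a pair of sequences with
`β n = ∑ r ≤ n, α r / ((q;q)_{n-r} (a;q)_{n+r+1})`. Summing `δ n * β n` over `n` and interchanging
the two summations turns the series into `∑ r, α r * γ r`, where `γ` is the transform of the weights
`δ`; for the weights needed here `γ` is evaluated by the `q`-Gauss sum with one parameter sent to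
infinity, or by a contiguous form of it.

The Bailey pairs are instances of the very well-poised `₆φ₅` sum, proved by a WZ certificate. In
base `q²` they give the pair with `β n = 1 / ((1 - q^{2n+1}) (q²;q²)_n²)`. Its even and odd parts
in `q` are, after replacing `q²` by `q`, the pairs relative to `q` with
`β n = 1 / ((1 - q^{2n+1}) (q;q)_n²)` and `β n = q^n / ((1 - q^{2n+1}) (q;q)_n²)` behind the second
to fifth identities. The sixth identity becomes, after one transformation with `a = 0`, a false
theta identity of Rogers, and the seventh is the contiguous `q`-Gauss sum itself.
-/

open Filter Topology Finset

section General

variable {𝕜 : Type*} [NormedField 𝕜] {q a : 𝕜}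

theorem norm_pow_lt_one (hq : ‖q‖ < 1) {n : ℕ} (hn : n ≠ 0) : ‖q ^ n‖ < 1 := by
  rw [norm_pow]
  exact pow_lt_one₀ (norm_nonneg q) hq hn

theorem norm_sq_lt_one (hq : ‖q‖ < 1) : ‖q ^ 2‖ < 1 := norm_pow_lt_one hq two_ne_zero

theorem norm_pow_le_one (hq : ‖q‖ < 1) (n : ℕ) : ‖q ^ n‖ ≤ 1 := by
  rw [norm_pow]
  exact pow_le_one₀ (norm_nonneg q) hq.le

theorem norm_neg_one_pow_mul_pow_le_one (hq : ‖q‖ < 1) (r n : ℕ) : ‖(-1) ^ r * q ^ n‖ ≤ 1 := by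
  simpa using norm_pow_le_one hq n

theorem norm_one_add_pow_le_two (hq : ‖q‖ < 1) (n : ℕ) : ‖1 + q ^ n‖ ≤ 2 := by
  have h := norm_add_le 1 (q ^ n)
  rw [norm_one] at h
  linarith [norm_pow_le_one hq n]

theorem norm_mul_pow_lt_one (ha : ‖a‖ < 1) (hq : ‖q‖ < 1) (n : ℕ) : ‖a * q ^ n‖ < 1 := by
  rw [norm_mul]
  exact mul_lt_one_of_nonneg_of_lt_one_left (norm_nonneg a) ha (norm_pow_le_one hq n)

theorem one_sub_ne_zero_of_norm_lt_one (ha : ‖a‖ < 1) : 1 - a ≠ 0 := by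
  rintro h
  simp [← sub_eq_zero.1 h] at ha

theorem one_sub_pow_ne_zero (hq : ‖q‖ < 1) {n : ℕ} (hn : n ≠ 0) : 1 - q ^ n ≠ 0 :=
  one_sub_ne_zero_of_norm_lt_one (norm_pow_lt_one hq hn)

theorem one_add_pow_ne_zero (hq : ‖q‖ < 1) {n : ℕ} (hn : n ≠ 0) : 1 + q ^ n ≠ 0 := by
  rw [← sub_neg_eq_add]
  exact one_sub_ne_zero_of_norm_lt_one (norm_neg (q ^ n) ▸ norm_pow_lt_one hq hn)

theorem one_sub_mul_pow_ne_zero (ha : ‖a‖ < 1) (hq : ‖q‖ < 1) (n : ℕ) : 1 - a * q ^ n ≠ 0 :=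
  one_sub_ne_zero_of_norm_lt_one (norm_mul_pow_lt_one ha hq n)

theorem tendsto_mul_pow_zero (a : 𝕜) (hq : ‖q‖ < 1) :
    Tendsto (fun n : ℕ => a * q ^ n) atTop (𝓝 0) := by
  simpa using (tendsto_pow_atTop_nhds_zero_of_norm_lt_one hq).const_mul a

theorem exists_norm_le_of_tendsto {E : Type*} [SeminormedAddCommGroup E] {f : ℕ → E} {l : E}
    (h : Tendsto f atTop (𝓝 l)) : ∃ C, ∀ n, ‖f n‖ ≤ C :=
  let ⟨C, hC⟩ := h.norm.bddAbove_range
  ⟨C, fun n => hC ⟨n, rfl⟩⟩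

theorem summable_pow_of_le [CompleteSpace 𝕜] (hq : ‖q‖ < 1) {f : ℕ → ℕ} (hf : ∀ n, n ≤ f n) :
    Summable fun n => q ^ f n := by
  refine Summable.of_norm_bounded (summable_geometric_of_lt_one (norm_nonneg q) hq) fun n => ?_
  rw [norm_pow]
  exact pow_le_pow_of_le_one (norm_nonneg q) hq.le (hf n)

theorem summable_prod_range_of_tendsto_zero [CompleteSpace 𝕜] {v : ℕ → 𝕜}
    (hv : Tendsto v atTop (𝓝 0)) : Summable fun n => ∏ k ∈ range n, v k := by
  refine summable_of_ratio_norm_eventually_le (r := 1 / 2) (by norm_num) ?_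
  filter_upwards [hv.norm.eventually (ge_mem_nhds (show ‖(0 : 𝕜)‖ < 1 / 2 by norm_num))] with n hn
  rw [prod_range_succ, norm_mul, mul_comm]
  gcongr

theorem hasSum_of_eq_of_eq {ι M : Type*} [AddCommMonoid M] [TopologicalSpace M] {f g : ι → M}
    {s t : M} (h : HasSum f s) (hfg : ∀ n, g n = f n) (hst : t = s) : HasSum g t := by
  rwa [hst, funext hfg]

theorem hasSum_sub_nat_add {G : Type*} [AddCommGroup G] [TopologicalSpace G]
    [IsTopologicalAddGroup G] {f : ℕ → G} (hf : Summable f) (k : ℕ) :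
    HasSum (fun n => f n - f (n + k)) (∑ i ∈ range k, f i) := by
  simpa using hf.hasSum.sub ((hasSum_nat_add_iff' k).2 hf.hasSum)

theorem hasSum_pairs {M : Type*} [AddCommMonoid M] [TopologicalSpace M] [ContinuousAdd M]
    [RegularSpace M] {f : ℕ → M} {s : M} (hf : HasSum f s) :
    HasSum (fun k => f (2 * k) + f (2 * k + 1)) s := by
  have h := ((Nat.divModEquiv 2).symm.hasSum_iff.2 hf).prod_fiberwise fun k => hasSum_fintype _
  simpa [Fin.sum_univ_two, Nat.divModEquiv, mul_comm] using h

theorem summable_prod_mul_of_bounded [CompleteSpace 𝕜] {δ α : ℕ → 𝕜} {u : ℕ → ℕ → 𝕜}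
    {C M : ℝ}
    (hδ : Summable fun n : ℕ => ((n : ℝ) + 1) * ‖δ n‖) (hα : ∀ r, ‖α r‖ ≤ M)
    (hu : ∀ n r, ‖u n r‖ ≤ C) (hu₀ : ∀ n r, n < r → u n r = 0) :
    Summable fun p : ℕ × ℕ => α p.2 * (δ p.1 * u p.1 p.2) := by
  have hrow : ∀ n, HasSum (fun r => ‖α r * (δ n * u n r)‖)
      (∑ r ∈ range (n + 1), ‖α r * (δ n * u n r)‖) := fun n =>
    hasSum_sum_of_ne_finset_zero fun r hr => by
      rw [hu₀ n r (by simpa using hr), mul_zero, mul_zero, norm_zero]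
  refine Summable.of_norm ((summable_prod_of_nonneg fun _ => norm_nonneg _).2
    ⟨fun n => (hrow n).summable, ?_⟩)
  refine (hδ.mul_right (M * C)).of_nonneg_of_le (fun n => tsum_nonneg fun _ => norm_nonneg _)
    fun n => ?_
  rw [(hrow n).tsum_eq]
  calc ∑ r ∈ range (n + 1), ‖α r * (δ n * u n r)‖
      ≤ ∑ _r ∈ range (n + 1), M * (‖δ n‖ * C) := sum_le_sum fun r _ => by
        have := (norm_nonneg _).trans (hα r)
        rw [norm_mul, norm_mul]
        gcongr
        exacts [hα r, hu n r]
    _ = ((n : ℝ) + 1) * ‖δ n‖ * (M * C) := by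
        rw [sum_const, card_range, nsmul_eq_mul, Nat.cast_succ]
        ring

end General

section QPoch

variable {q a : ℂ}

theorem qPoch_zero (a q : ℂ) : qPoch a q 0 = 1 := prod_range_zero _

theorem qPoch_succ (a q : ℂ) (n : ℕ) : qPoch a q (n + 1) = qPoch a q n * (1 - a * q ^ n) :=
  prod_range_succ _ n

theorem qPoch_succ' (a q : ℂ) (n : ℕ) : qPoch a q (n + 1) = (1 - a) * qPoch (a * q) q n := by
  simp only [qPoch, prod_range_succ', pow_zero, mul_one, pow_succ', mul_assoc, mul_comm (1 - a)]

theorem qPoch_zero_left (q : ℂ) (n : ℕ) : qPoch 0 q n = 1 := by simp [qPoch]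

theorem qPoch_mul_qPoch_neg (a q : ℂ) (n : ℕ) :
    qPoch a q n * qPoch (-a) q n = qPoch (a ^ 2) (q ^ 2) n := by
  simp only [qPoch, ← prod_mul_distrib]
  exact prod_congr rfl fun k _ => by ring

theorem qPoch_ne_zero (h : ∀ k, 1 - a * q ^ k ≠ 0) (n : ℕ) : qPoch a q n ≠ 0 :=
  prod_ne_zero_iff.2 fun k _ => h k

theorem qPochInf_zero_left (q : ℂ) : qPochInf 0 q = 1 := by simp [qPochInf]

theorem qPochInf_eq_qPoch_mul (a : ℂ) (hq : ‖q‖ < 1) (n : ℕ) :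
    qPochInf a q = qPoch a q n * qPochInf (a * q ^ n) q := by
  have hshift : (fun k : ℕ => 1 - a * q ^ (k + n)) = fun k => 1 - a * q ^ n * q ^ k := by
    funext k
    ring
  have h := Multipliable.prod_mul_tprod_nat_mul' (f := fun k : ℕ => 1 - a * q ^ k) (k := n)
    (by rw [hshift]; exact multipliable_qPochInf (a * q ^ n) q hq)
  rw [hshift] at h
  exact h.symm

theorem qPochInf_eq_one_sub_mul (a : ℂ) (hq : ‖q‖ < 1) :
    qPochInf a q = (1 - a) * qPochInf (a * q) q := by
  simpa [qPoch] using qPochInf_eq_qPoch_mul a hq 1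

theorem qPochInf_ne_zero (ha : ‖a‖ < 1) (hq : ‖q‖ < 1) : qPochInf a q ≠ 0 := by
  have hsum : Summable fun k : ℕ => ‖-(a * q ^ k)‖ := by
    simp only [norm_neg, norm_mul, norm_pow]
    exact (summable_geometric_of_lt_one (norm_nonneg q) hq).mul_left _
  simpa only [qPochInf, ← sub_eq_add_neg] using tprod_one_add_ne_zero_of_summable
    (fun k => by simpa only [← sub_eq_add_neg] using one_sub_mul_pow_ne_zero ha hq k) hsum

theorem tendsto_qPoch (a : ℂ) (hq : ‖q‖ < 1) :
    Tendsto (qPoch a q) atTop (𝓝 (qPochInf a q)) :=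
  (multipliable_qPochInf a q hq).tendsto_prod_tprod_nat

theorem inv_qPoch (ha : ‖a‖ < 1) (hq : ‖q‖ < 1) (n : ℕ) :
    (qPoch a q n)⁻¹ = qPochInf (a * q ^ n) q / qPochInf a q := by
  rw [qPochInf_eq_qPoch_mul a hq n]
  have htail := qPochInf_ne_zero (norm_mul_pow_lt_one ha hq n) hq
  field_simp

theorem exists_norm_inv_qPoch_le (ha : ‖a‖ < 1) (hq : ‖q‖ < 1) :
    ∃ C, ∀ n, ‖(qPoch a q n)⁻¹‖ ≤ C :=
  exists_norm_le_of_tendsto ((tendsto_qPoch a hq).inv₀ (qPochInf_ne_zero ha hq))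

theorem tendsto_qPochInf_mul_pow (a : ℂ) (hq : ‖q‖ < 1) :
    Tendsto (fun n : ℕ => qPochInf (a * q ^ n) q) atTop (𝓝 1) := by
  obtain ⟨m, hm⟩ : ∃ m : ℕ, ‖a * q ^ m‖ < 1 := by
    have h := (tendsto_mul_pow_zero a hq).norm
    rw [norm_zero] at h
    exact (h.eventually (gt_mem_nhds one_pos)).exists
  have hne := qPochInf_ne_zero hm hq
  have h : Tendsto (fun n => qPochInf (a * q ^ m * q ^ n) q) atTop (𝓝 1) := by
    have h := ((tendsto_qPoch (a * q ^ m) hq).inv₀ hne).mul_const (qPochInf (a * q ^ m) q)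
    simpa only [inv_qPoch hm hq, div_mul_cancel₀ _ hne, inv_mul_cancel₀ hne] using h
  refine (tendsto_add_atTop_iff_nat m).1 (h.congr fun n => ?_)
  rw [add_comm n m, pow_add, mul_assoc]

end QPoch

/-- The weight `∏_{k<n} q^k (c q^k - y) = (-1)^n q^{n(n-1)/2} (y - c)(y - cq)⋯(y - cq^{n-1})`.
For `y = aq/ρ₁` and `c = aq` it is the limit as `ρ₂ → ∞` of the weight
`(ρ₁;q)_n (ρ₂;q)_n (aq/ρ₁ρ₂)^n` of Bailey's lemma; this form makes sense for `y = 0` too. -/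
noncomputable def qWeight (y c q : ℂ) (n : ℕ) : ℂ :=
  ∏ k ∈ range n, q ^ k * (c * q ^ k - y)

section QWeight

variable {q : ℂ}

theorem qWeight_zero (y c q : ℂ) : qWeight y c q 0 = 1 := prod_range_zero _

theorem qWeight_succ (y c q : ℂ) (n : ℕ) :
    qWeight y c q (n + 1) = qWeight y c q n * (q ^ n * (c * q ^ n - y)) :=
  prod_range_succ _ n

theorem qWeight_mul_mul (y c s q : ℂ) (n : ℕ) :
    qWeight (y * s) (c * s) q n = s ^ n * qWeight y c q n := by
  simp only [qWeight, pow_eq_prod_const s n, ← prod_mul_distrib]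
  exact prod_congr rfl fun k _ => by ring

theorem qWeight_add (y c q : ℂ) (m r : ℕ) :
    qWeight y c q (m + r) = qWeight y c q r * qWeight (y * q ^ r) (c * q ^ (2 * r)) q m := by
  rw [add_comm m r, qWeight, prod_range_add]
  exact congrArg _ (prod_congr rfl fun k _ => by ring)

theorem summable_succ_mul_norm_qWeight (y c : ℂ) (hq : ‖q‖ < 1) :
    Summable fun n : ℕ => ((n : ℝ) + 1) * ‖qWeight y c q n‖ := by
  have hlim : Tendsto (fun k : ℕ => 2 * ‖q ^ k * (c * q ^ k - y)‖) atTop (𝓝 0) := by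
    have h := (tendsto_pow_atTop_nhds_zero_of_norm_lt_one hq).mul
      ((tendsto_mul_pow_zero c hq).sub_const y)
    simpa using h.norm.const_mul 2
  refine (summable_prod_range_of_tendsto_zero hlim).of_nonneg_of_le
    (fun n => by positivity) fun n => ?_
  rw [prod_mul_distrib, prod_const, card_range, ← norm_prod, ← qWeight]
  gcongr
  exact_mod_cast Nat.lt_two_pow_self

theorem summable_norm_qWeight (y c : ℂ) (hq : ‖q‖ < 1) :
    Summable fun n : ℕ => ‖qWeight y c q n‖ :=
  (summable_succ_mul_norm_qWeight y c hq).of_nonneg_of_le (fun n => norm_nonneg _) fun n =>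
    le_mul_of_one_le_left (norm_nonneg _) (by simp)

end QWeight

/-- The summand of the `q`-Gauss sum with one numerator parameter sent to infinity, multiplied by
`(c;q)_∞` so that no condition on `c` is needed. -/
noncomputable def qGaussTerm (y c q : ℂ) (m : ℕ) : ℂ :=
  qWeight y c q m * (qPochInf (c * q ^ m) q / qPoch q q m)

section QGauss

variable {q : ℂ}

theorem exists_summable_norm_qGaussTerm_le (y c : ℂ) (hq : ‖q‖ < 1) :
    ∃ u : ℕ → ℝ, Summable u ∧ ∀ N m, ‖qGaussTerm (y * q ^ N) (c * q ^ N) q m‖ ≤ u m := by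
  obtain ⟨A, hA⟩ := exists_norm_le_of_tendsto (tendsto_qPochInf_mul_pow c hq)
  obtain ⟨B, hB⟩ := exists_norm_inv_qPoch_le hq hq
  refine ⟨fun m => ‖qWeight y c q m‖ * (A * B), (summable_norm_qWeight y c hq).mul_right _,
    fun N m => ?_⟩
  have hweight : ‖qWeight (y * q ^ N) (c * q ^ N) q m‖ ≤ ‖qWeight y c q m‖ := by
    rw [qWeight_mul_mul, norm_mul, ← pow_mul]
    exact mul_le_of_le_one_left (norm_nonneg _) (norm_pow_le_one hq _)
  rw [qGaussTerm, norm_mul, div_eq_mul_inv, norm_mul, mul_assoc c, ← pow_add]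
  exact mul_le_mul hweight (mul_le_mul (hA _) (hB m) (norm_nonneg _)
    ((norm_nonneg _).trans (hA 0))) (by positivity) (norm_nonneg _)

theorem summable_qGaussTerm (y c : ℂ) (hq : ‖q‖ < 1) : Summable (qGaussTerm y c q) := by
  obtain ⟨u, hu, h⟩ := exists_summable_norm_qGaussTerm_le y c hq
  exact Summable.of_norm_bounded hu fun m => by simpa using h 0 m

theorem qGaussTerm_sub (y c : ℂ) (hq : ‖q‖ < 1) (m : ℕ) :
    qGaussTerm y c q m - (1 - y) * qGaussTerm (y * q) (c * q) q m =
      (1 - q ^ m) * qGaussTerm y c q m - (1 - q ^ (m + 1)) * qGaussTerm y c q (m + 1) := by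
  have hm := one_sub_pow_ne_zero hq m.succ_ne_zero
  simp only [qGaussTerm, qWeight_mul_mul, qWeight_succ, qPoch_succ, ← pow_succ']
  rw [qPochInf_eq_one_sub_mul (c * q ^ m) hq, mul_right_comm c q, mul_assoc c, ← pow_succ]
  field_simp
  ring

theorem tsum_qGaussTerm_eq_one_sub_mul (y c : ℂ) (hq : ‖q‖ < 1) :
    ∑' m, qGaussTerm y c q m = (1 - y) * ∑' m, qGaussTerm (y * q) (c * q) q m := by
  have hs := summable_qGaussTerm y c hq
  have hs' := (summable_qGaussTerm (y * q) (c * q) hq).mul_left (1 - y)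
  have htel : Summable fun m => (1 - q ^ m) * qGaussTerm y c q m := by
    refine Summable.of_norm_bounded (hs.norm.mul_left 2) fun m => ?_
    rw [norm_mul]
    gcongr
    refine (norm_sub_le _ _).trans ?_
    rw [norm_one]
    linarith [norm_pow_le_one hq m]
  rw [← sub_eq_zero, ← tsum_mul_left, ← hs.tsum_sub hs', tsum_congr (qGaussTerm_sub y c hq),
    (hasSum_sub_nat_add htel 1).tsum_eq]
  simp

theorem tsum_qGaussTerm_eq_qPoch_mul (y c : ℂ) (hq : ‖q‖ < 1) (N : ℕ) :
    ∑' m, qGaussTerm y c q m =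
      qPoch y q N * ∑' m, qGaussTerm (y * q ^ N) (c * q ^ N) q m := by
  induction N with
  | zero => simp [qPoch_zero]
  | succ N ih =>
    rw [ih, tsum_qGaussTerm_eq_one_sub_mul _ _ hq, qPoch_succ, pow_succ]
    simp only [mul_assoc]

theorem tendsto_tsum_qGaussTerm (y c : ℂ) (hq : ‖q‖ < 1) :
    Tendsto (fun N => ∑' m, qGaussTerm (y * q ^ N) (c * q ^ N) q m) atTop (𝓝 1) := by
  obtain ⟨u, hu, hle⟩ := exists_summable_norm_qGaussTerm_le y c hq
  rw [← tsum_ite_eq (0 : ℕ) fun _ => (1 : ℂ)]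
  refine tendsto_tsum_of_dominated_convergence hu (fun m => ?_)
    (Eventually.of_forall fun N m => hle N m)
  have hprod : Tendsto (fun N : ℕ => qPochInf (c * q ^ N * q ^ m) q) atTop (𝓝 1) :=
    (tendsto_qPochInf_mul_pow (c * q ^ m) hq).congr fun N => by rw [mul_right_comm]
  simp only [qGaussTerm, qWeight_mul_mul]
  rcases eq_or_ne m 0 with rfl | hm
  · simpa [qPoch_zero, qWeight_zero] using hprod
  · have hpow : Tendsto (fun N : ℕ => (q ^ N) ^ m) atTop (𝓝 0) := by
      simpa only [← pow_mul, mul_comm m] using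
        tendsto_pow_atTop_nhds_zero_of_norm_lt_one (norm_pow_lt_one hq hm)
    simpa [hm] using (hpow.mul_const (qWeight y c q m)).mul (hprod.div_const (qPoch q q m))

theorem hasSum_qGaussTerm (y c : ℂ) (hq : ‖q‖ < 1) :
    HasSum (qGaussTerm y c q) (qPochInf y q) := by
  have h := (tendsto_qPoch y hq).mul (tendsto_tsum_qGaussTerm y c hq)
  simp only [← tsum_qGaussTerm_eq_qPoch_mul y c hq, mul_one] at h
  exact tendsto_nhds_unique tendsto_const_nhds h ▸ (summable_qGaussTerm y c hq).hasSum

theorem hasSum_qGaussTerm_contiguous (y c : ℂ) (hq : ‖q‖ < 1) :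
    HasSum (fun m => qWeight y c q m * (qPochInf (c * q ^ (m + 1)) q / qPoch q q m))
      ((1 + c - y) * qPochInf (y * q) q) := by
  have h := (hasSum_qGaussTerm y c hq).add ((hasSum_qGaussTerm (y * q) (c * q) hq).mul_left c)
  refine hasSum_of_eq_of_eq h (fun m => ?_) ?_
  · simp only [qGaussTerm, qWeight_mul_mul]
    rw [qPochInf_eq_one_sub_mul (c * q ^ m) hq, mul_right_comm c q, pow_succ, ← mul_assoc c]
    ring
  · rw [qPochInf_eq_one_sub_mul y hq]
    ring

end QGauss

/-- The matrix `1 / ((q;q)_{n-r} (a;q)_{n+r+1})` of the Bailey transform, zero for `r > n`. -/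
noncomputable def baileyKernel (a q : ℂ) (n r : ℕ) : ℂ :=
  if r ≤ n then (qPoch q q (n - r) * qPoch a q (n + r + 1))⁻¹ else 0

/-- `(α, β)` is a Bailey pair relative to `a` in base `q`, with `α` divided by `1 - a` compared to
the usual normalisation `β n = ∑ r ≤ n, α r / ((q;q)_{n-r} (aq;q)_{n+r})`. -/
def IsBaileyPair (a q : ℂ) (α β : ℕ → ℂ) : Prop :=
  ∀ n, ∑ r ∈ range (n + 1), α r * baileyKernel a q n r = β n

section BaileyLemma

variable {a q : ℂ} {α β : ℕ → ℂ}

theorem baileyKernel_eq_zero (a q : ℂ) {n r : ℕ} (h : n < r) : baileyKernel a q n r = 0 :=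
  if_neg (not_le.2 h)

theorem baileyKernel_add_right (a q : ℂ) (m r : ℕ) :
    baileyKernel a q (m + r) r = (qPoch q q m)⁻¹ * (qPoch a q (m + 2 * r + 1))⁻¹ := by
  rw [baileyKernel, if_pos (Nat.le_add_left r m), Nat.add_sub_cancel, two_mul, ← add_assoc m r r,
    mul_inv]

theorem exists_norm_baileyKernel_le (ha : ‖a‖ < 1) (hq : ‖q‖ < 1) :
    ∃ C, ∀ n r, ‖baileyKernel a q n r‖ ≤ C := by
  obtain ⟨A, hA⟩ := exists_norm_inv_qPoch_le ha hq
  obtain ⟨B, hB⟩ := exists_norm_inv_qPoch_le hq hq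
  have hA₀ := (norm_nonneg _).trans (hA 0)
  have hB₀ := (norm_nonneg _).trans (hB 0)
  refine ⟨B * A, fun n r => ?_⟩
  rw [baileyKernel]
  split_ifs
  · rw [mul_inv, norm_mul]
    exact mul_le_mul (hB _) (hA _) (norm_nonneg _) hB₀
  · rw [norm_zero]
    positivity

theorem hasSum_qWeight_mul_baileyKernel (y : ℂ) (ha : ‖a‖ < 1) (hq : ‖q‖ < 1) (r : ℕ) :
    HasSum (fun n => qWeight y (a * q) q n * baileyKernel a q n r)
      (qWeight y (a * q) q r * qPochInf (y * q ^ r) q / qPochInf a q) := by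
  rw [← hasSum_nat_add_iff' r, sum_eq_zero fun n hn => by
    rw [baileyKernel_eq_zero a q (mem_range.1 hn), mul_zero], sub_zero]
  refine hasSum_of_eq_of_eq ((hasSum_qGaussTerm (y * q ^ r) (a * q * q ^ (2 * r)) hq).mul_left
    (qWeight y (a * q) q r / qPochInf a q)) (fun m => ?_) ?_
  · rw [baileyKernel_add_right, qWeight_add, inv_qPoch ha hq, qGaussTerm,
      show a * q * q ^ (2 * r) * q ^ m = a * q ^ (m + 2 * r + 1) by ring]
    ring
  · ring

theorem hasSum_qWeight_mul_baileyKernel_contiguous (y : ℂ) (ha : ‖a‖ < 1) (hq : ‖q‖ < 1)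
    (r : ℕ) :
    HasSum (fun n => qWeight y a q n * baileyKernel a q n r)
      (qWeight y a q r * ((1 + a * q ^ (2 * r) - y * q ^ r) * qPochInf (y * q ^ (r + 1)) q) /
        qPochInf a q) := by
  rw [← hasSum_nat_add_iff' r, sum_eq_zero fun n hn => by
    rw [baileyKernel_eq_zero a q (mem_range.1 hn), mul_zero], sub_zero]
  refine hasSum_of_eq_of_eq ((hasSum_qGaussTerm_contiguous (y * q ^ r) (a * q ^ (2 * r))
    hq).mul_left (qWeight y a q r / qPochInf a q)) (fun m => ?_) ?_
  · rw [baileyKernel_add_right, qWeight_add, inv_qPoch ha hq,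
      show a * q ^ (2 * r) * q ^ (m + 1) = a * q ^ (m + 2 * r + 1) by ring]
    ring
  · rw [mul_assoc y, ← pow_succ]
    ring

theorem IsBaileyPair.hasSum_mul (h : IsBaileyPair a q α β) (ha : ‖a‖ < 1) (hq : ‖q‖ < 1)
    {M : ℝ} (hα : ∀ r, ‖α r‖ ≤ M) {δ γ : ℕ → ℂ}
    (hδ : Summable fun n : ℕ => ((n : ℝ) + 1) * ‖δ n‖)
    (hγ : ∀ r, HasSum (fun n => δ n * baileyKernel a q n r) (γ r)) :
    Summable (fun r => α r * γ r) ∧ HasSum (fun n => δ n * β n) (∑' r, α r * γ r) := by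
  obtain ⟨C, hC⟩ := exists_norm_baileyKernel_le ha hq
  have hF := summable_prod_mul_of_bounded hδ hα hC fun n r => baileyKernel_eq_zero a q
  have hrows := hF.hasSum.prod_fiberwise fun n =>
    hasSum_sum_of_ne_finset_zero (s := range (n + 1)) fun r hr => by
      rw [baileyKernel_eq_zero a q (by simpa using hr), mul_zero, mul_zero]
  have hcols := ((Equiv.prodComm ℕ ℕ).hasSum_iff.2 hF.hasSum).prod_fiberwise
    fun r => (hγ r).mul_left (α r)
  refine ⟨hcols.summable, ?_⟩
  refine hasSum_of_eq_of_eq hrows (fun n => ?_) hcols.tsum_eq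
  rw [← h n, mul_sum]
  exact sum_congr rfl fun r _ => mul_left_comm _ _ _

theorem IsBaileyPair.hasSum_qWeight (h : IsBaileyPair a q α β) (ha : ‖a‖ < 1) (hq : ‖q‖ < 1)
    {M : ℝ} (hα : ∀ r, ‖α r‖ ≤ M) (y : ℂ) :
    Summable (fun r => α r * (qWeight y (a * q) q r * qPochInf (y * q ^ r) q)) ∧
      HasSum (fun n => qWeight y (a * q) q n * β n)
        ((∑' r, α r * (qWeight y (a * q) q r * qPochInf (y * q ^ r) q)) / qPochInf a q) := by
  have := h.hasSum_mul ha hq hα (summable_succ_mul_norm_qWeight y (a * q) hq)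
    (hasSum_qWeight_mul_baileyKernel y ha hq)
  simpa only [← mul_div_assoc, div_eq_mul_inv, ← mul_assoc, tsum_mul_right,
    summable_mul_right_iff (inv_ne_zero (qPochInf_ne_zero ha hq))] using this

theorem IsBaileyPair.hasSum_mul_qPoch (h : IsBaileyPair a q α β) (ha : ‖a‖ < 1) (hq : ‖q‖ < 1)
    {M : ℝ} (hα : ∀ r, ‖α r‖ ≤ M) {y : ℂ} (hy : ‖y‖ < 1) {v : ℕ → ℂ}
    (hv : ∀ n, qWeight y (a * q) q n = v n * qPoch y q n) :
    Summable (fun r => α r * v r) ∧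
      HasSum (fun n => v n * qPoch y q n * β n)
        (qPochInf y q / qPochInf a q * ∑' r, α r * v r) := by
  have hterm : ∀ r, α r * (qWeight y (a * q) q r * qPochInf (y * q ^ r) q) =
      α r * v r * qPochInf y q := fun r => by
    rw [hv, qPochInf_eq_qPoch_mul y hq r]
    ring
  obtain ⟨hsum, h⟩ := h.hasSum_qWeight ha hq hα y
  simp only [hterm, tsum_mul_right] at hsum h
  simp only [hv] at h
  exact ⟨(summable_mul_right_iff (qPochInf_ne_zero hy hq)).1 hsum,
    hasSum_of_eq_of_eq h (fun _ => rfl) (by ring)⟩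

theorem IsBaileyPair.hasSum_qWeight_contiguous (h : IsBaileyPair a q α β) (ha : ‖a‖ < 1)
    (hq : ‖q‖ < 1) {M : ℝ} (hα : ∀ r, ‖α r‖ ≤ M) (y : ℂ) :
    HasSum (fun n => qWeight y a q n * β n)
      ((∑' r, α r * (qWeight y a q r *
        ((1 + a * q ^ (2 * r) - y * q ^ r) * qPochInf (y * q ^ (r + 1)) q))) / qPochInf a q) := by
  have := (h.hasSum_mul ha hq hα (summable_succ_mul_norm_qWeight y a hq)
    (hasSum_qWeight_mul_baileyKernel_contiguous y ha hq)).2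
  simpa only [← mul_div_assoc, tsum_div_const] using this

theorem IsBaileyPair.const_mul (h : IsBaileyPair a q α β) (c : ℂ) :
    IsBaileyPair a q (fun r => c * α r) (fun n => c * β n) := fun n => by
  simp only [← h n, mul_sum, mul_assoc]

theorem IsBaileyPair.add {α' β' : ℕ → ℂ} (h : IsBaileyPair a q α β)
    (h' : IsBaileyPair a q α' β') :
    IsBaileyPair a q (fun r => α r + α' r) (fun n => β n + β' n) := fun n => by
  simp only [← h n, ← h' n, ← sum_add_distrib, add_mul]

end BaileyLemma

/-- The series `t` for which `(1 - a q^{2r}) t_r` is the `α`-sequence of the Bailey pair coming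
from the very well-poised `₆φ₅` sum with parameters `a`, `b = a/x`, `c = q/s`. In terms of `x` and
`s` it also covers the confluent cases `a = 0` and `s = 0`. -/
noncomputable def wellPoisedTerm (a x s q : ℂ) (r : ℕ) : ℂ :=
  qPoch a q r * qWeight x a q r * (∏ k ∈ range r, (s - q * q ^ k)) /
    (qPoch q q r * qPoch (x * q) q r * qPoch (a * s) q r)

/-- The WZ certificate for the recurrence in `n` of `∑ r, (1 - a q^{2r}) t_r K(n, r)`, where
`t` is `wellPoisedTerm a x s q` and `K` is `baileyKernel a q`. -/
noncomputable def wellPoisedCertificate (a x s q : ℂ) (n r : ℕ) : ℂ :=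
  -((1 - q ^ r) * (1 - x * q ^ r) * (q ^ (n + 1 - r) - a * s * q ^ n) *
    (1 - a * q ^ (n + r + 1)) * wellPoisedTerm a x s q r * baileyKernel a q (n + 1) r)

section WellPoised

variable {a x s q : ℂ}

theorem baileyKernel_eq_mul_succ_left (ha : ∀ k, 1 - a * q ^ k ≠ 0)
    (hq : ∀ k, 1 - q * q ^ k ≠ 0) (d r : ℕ) :
    baileyKernel a q (d + r) r =
      (1 - q * q ^ d) * (1 - a * q ^ (d + 2 * r + 1)) * baileyKernel a q (d + r + 1) r := by
  have hqd := hq d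
  have had := ha (d + 2 * r + 1)
  rw [add_right_comm d r, baileyKernel_add_right, baileyKernel_add_right, qPoch_succ q,
    show d + 1 + 2 * r + 1 = d + 2 * r + 1 + 1 by ring, qPoch_succ a q (d + 2 * r + 1), mul_inv,
    mul_inv]
  field_simp

theorem mul_baileyKernel_succ_succ (ha : ∀ k, 1 - a * q ^ k ≠ 0)
    (hq : ∀ k, 1 - q * q ^ k ≠ 0) (d r : ℕ) :
    (1 - a * q ^ (d + 2 * r + 2)) * baileyKernel a q (d + r + 1) (r + 1) =
      (1 - q * q ^ d) * baileyKernel a q (d + r + 1) r := by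
  have hqd := hq d
  have had := ha (d + 2 * r + 2)
  rw [add_assoc d r 1, baileyKernel_add_right, ← add_assoc d r 1, add_right_comm d r 1,
    baileyKernel_add_right, qPoch_succ q, show d + 2 * (r + 1) + 1 = d + 2 * r + 2 + 1 by ring,
    qPoch_succ a, show d + 1 + 2 * r + 1 = d + 2 * r + 2 by ring, mul_inv, mul_inv]
  field_simp

theorem wellPoisedTerm_succ (hq : ∀ k, 1 - q * q ^ k ≠ 0) (hx : ∀ k, 1 - x * q * q ^ k ≠ 0)
    (has : ∀ k, 1 - a * s * q ^ k ≠ 0) (r : ℕ) :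
    (1 - q * q ^ r) * (1 - x * q * q ^ r) * (1 - a * s * q ^ r) * wellPoisedTerm a x s q (r + 1) =
      (1 - a * q ^ r) * (q ^ r * (a * q ^ r - x)) * (s - q * q ^ r) *
        wellPoisedTerm a x s q r := by
  have hqr := hq r
  have hxr := hx r
  have hasr := has r
  have hratio : wellPoisedTerm a x s q (r + 1) = wellPoisedTerm a x s q r *
      ((1 - a * q ^ r) * (q ^ r * (a * q ^ r - x)) * (s - q * q ^ r) /
        ((1 - q * q ^ r) * (1 - x * q * q ^ r) * (1 - a * s * q ^ r))) := by
    simp only [wellPoisedTerm, qPoch_succ, qWeight_succ, prod_range_succ, div_mul_div_comm]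
    congr 1 <;> ring
  rw [hratio, mul_left_comm, mul_div_cancel₀ _ (by simp [hqr, hxr, hasr]), mul_comm]

theorem wellPoisedCertificate_sub (ha : ∀ k, 1 - a * q ^ k ≠ 0) (hq : ∀ k, 1 - q * q ^ k ≠ 0)
    (hx : ∀ k, 1 - x * q * q ^ k ≠ 0) (has : ∀ k, 1 - a * s * q ^ k ≠ 0) {n r : ℕ}
    (hr : r ≤ n + 1) :
    wellPoisedCertificate a x s q n (r + 1) - wellPoisedCertificate a x s q n r =
      (1 - a * q ^ (2 * r)) * wellPoisedTerm a x s q r *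
        ((1 - q * q ^ n) * (1 - x * q * q ^ n) * (1 - a * s * q ^ n) *
          baileyKernel a q (n + 1) r - (1 - x * s * q ^ n) * baileyKernel a q n r) := by
  rcases hr.eq_or_lt with rfl | hr
  · rw [wellPoisedCertificate, wellPoisedCertificate, baileyKernel_eq_zero a q n.lt_succ_self,
      baileyKernel_eq_zero a q (n + 1).lt_succ_self, Nat.sub_self]
    ring
  · obtain ⟨d, rfl⟩ := Nat.exists_eq_add_of_le' (Nat.lt_succ_iff.1 hr)
    have hK := mul_baileyKernel_succ_succ ha hq d r
    have ht := wellPoisedTerm_succ hq hx has r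
    have hnext : wellPoisedCertificate a x s q (d + r) (r + 1) =
        -(q ^ d * ((1 - a * q ^ r) * (q ^ r * (a * q ^ r - x)) * (s - q * q ^ r) *
          wellPoisedTerm a x s q r) * ((1 - q * q ^ d) * baileyKernel a q (d + r + 1) r)) := by
      rw [← hK, ← ht, wellPoisedCertificate, Nat.add_sub_add_right, Nat.add_sub_cancel]
      ring
    rw [hnext, wellPoisedCertificate, baileyKernel_eq_mul_succ_left ha hq, add_right_comm d r 1,
      Nat.add_sub_cancel]
    ring

theorem sum_wellPoisedTerm_mul_baileyKernel_succ (ha : ∀ k, 1 - a * q ^ k ≠ 0)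
    (hq : ∀ k, 1 - q * q ^ k ≠ 0) (hx : ∀ k, 1 - x * q * q ^ k ≠ 0)
    (has : ∀ k, 1 - a * s * q ^ k ≠ 0) (n : ℕ) :
    (1 - q * q ^ n) * (1 - x * q * q ^ n) * (1 - a * s * q ^ n) *
        ∑ r ∈ range (n + 2),
          (1 - a * q ^ (2 * r)) * wellPoisedTerm a x s q r * baileyKernel a q (n + 1) r =
      (1 - x * s * q ^ n) * ∑ r ∈ range (n + 1),
        (1 - a * q ^ (2 * r)) * wellPoisedTerm a x s q r * baileyKernel a q n r := by
  have hfirst : wellPoisedCertificate a x s q n 0 = 0 := by simp [wellPoisedCertificate]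
  have hlast : wellPoisedCertificate a x s q n (n + 2) = 0 := by
    rw [wellPoisedCertificate, baileyKernel_eq_zero a q (n + 1).lt_succ_self, mul_zero, neg_zero]
  have htel := sum_range_sub (wellPoisedCertificate a x s q n) (n + 2)
  rw [hfirst, hlast, sub_zero, sum_congr rfl fun r hr => wellPoisedCertificate_sub ha hq hx has
    (Nat.lt_succ_iff.1 (mem_range.1 hr))] at htel
  have hextend := sum_range_succ (fun r =>
    (1 - a * q ^ (2 * r)) * wellPoisedTerm a x s q r * baileyKernel a q n r) (n + 1)
  rw [baileyKernel_eq_zero a q n.lt_succ_self, mul_zero, add_zero] at hextend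
  rw [← hextend, ← sub_eq_zero, mul_sum, mul_sum, ← sum_sub_distrib, ← htel]
  exact sum_congr rfl fun r _ => by ring

theorem isBaileyPair_wellPoised (ha : ∀ k, 1 - a * q ^ k ≠ 0) (hq : ∀ k, 1 - q * q ^ k ≠ 0)
    (hx : ∀ k, 1 - x * q * q ^ k ≠ 0) (has : ∀ k, 1 - a * s * q ^ k ≠ 0) :
    IsBaileyPair a q (fun r => (1 - a * q ^ (2 * r)) * wellPoisedTerm a x s q r)
      (fun n => qPoch (x * s) q n /
        (qPoch q q n * qPoch (x * q) q n * qPoch (a * s) q n)) := by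
  intro n
  induction n with
  | zero =>
    have ha₀ : 1 - a ≠ 0 := by simpa using ha 0
    simp [wellPoisedTerm, baileyKernel, qPoch, qWeight, ha₀]
  | succ n ih =>
    have hne : (1 - q * q ^ n) * (1 - x * q * q ^ n) * (1 - a * s * q ^ n) ≠ 0 :=
      mul_ne_zero (mul_ne_zero (hq n) (hx n)) (has n)
    rw [← mul_right_inj' hne, sum_wellPoisedTerm_mul_baileyKernel_succ ha hq hx has, ih]
    have hβ : qPoch (x * s) q (n + 1) /
        (qPoch q q (n + 1) * qPoch (x * q) q (n + 1) * qPoch (a * s) q (n + 1)) =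
        (1 - x * s * q ^ n) / ((1 - q * q ^ n) * (1 - x * q * q ^ n) * (1 - a * s * q ^ n)) *
          (qPoch (x * s) q n / (qPoch q q n * qPoch (x * q) q n * qPoch (a * s) q n)) := by
      simp only [qPoch_succ, div_mul_div_comm]
      congr 1 <;> ring
    beta_reduce
    rw [hβ, ← mul_assoc, mul_div_cancel₀ _ hne]

end WellPoised

section SpecialWeights

theorem half_sq_add_self_succ (n : ℕ) :
    ((n + 1) ^ 2 + (n + 1)) / 2 = (n ^ 2 + n) / 2 + (n + 1) := by
  rw [show (n + 1) ^ 2 + (n + 1) = n ^ 2 + n + (n + 1) * 2 by ring,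
    Nat.add_mul_div_right _ _ two_pos]

theorem half_two_mul_sq_add (k : ℕ) : ((2 * k) ^ 2 + 2 * k) / 2 = 2 * k ^ 2 + k :=
  Nat.div_eq_of_eq_mul_right two_pos (by ring)

theorem half_two_mul_add_one_sq_add (k : ℕ) :
    ((2 * k + 1) ^ 2 + (2 * k + 1)) / 2 = 2 * k ^ 2 + 3 * k + 1 :=
  Nat.div_eq_of_eq_mul_right two_pos (by ring)

theorem qWeight_zero_mul_self (q : ℂ) (n : ℕ) : qWeight 0 (q * q) q n = q ^ (n ^ 2 + n) := by
  induction n with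
  | zero => exact qWeight_zero _ _ _
  | succ n ih => rw [qWeight_succ, ih]; ring

theorem qWeight_mul_self (y z q : ℂ) (n : ℕ) :
    qWeight (y * q) (y * q * z) q n = (-y) ^ n * q ^ ((n ^ 2 + n) / 2) * qPoch z q n := by
  induction n with
  | zero => simp [qWeight_zero, qPoch_zero]
  | succ n ih => rw [qWeight_succ, ih, qPoch_succ, half_sq_add_self_succ]; ring

theorem qWeight_mul_self_sq (y z q : ℂ) (n : ℕ) :
    qWeight (y * q) (y * q * z) (q ^ 2) n = (-y) ^ n * q ^ (n ^ 2) * qPoch z (q ^ 2) n := by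
  induction n with
  | zero => simp [qWeight_zero, qPoch_zero]
  | succ n ih => rw [qWeight_succ, ih, qPoch_succ]; ring

theorem qWeight_neg_self (q : ℂ) (n : ℕ) :
    qWeight (-q) (q * q) q n = q ^ ((n ^ 2 + n) / 2) * qPoch (-q) q n := by
  simpa using qWeight_mul_self (-1) (-q) q n

theorem qWeight_neg_self_sq (q : ℂ) (n : ℕ) :
    qWeight (-q) (q ^ 2) (q ^ 2) n = q ^ (n ^ 2) * qPoch (-q) (q ^ 2) n := by
  simpa [sq] using qWeight_mul_self_sq (-1) (-q) q n

theorem qWeight_self_zero_sq (q : ℂ) (n : ℕ) :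
    qWeight q 0 (q ^ 2) n = (-1) ^ n * q ^ (n ^ 2) := by
  simpa [qPoch_zero_left] using qWeight_mul_self_sq 1 0 q n

theorem qWeight_neg_mul_sq_zero (q : ℂ) (n : ℕ) :
    qWeight (-q * q ^ 2) 0 (q ^ 2) n = q ^ (n ^ 2 + 2 * n) := by
  have h := qWeight_mul_self_sq (-q ^ 2) 0 q n
  rw [mul_zero, neg_neg, qPoch_zero_left, neg_mul, mul_comm, ← neg_mul] at h
  rw [h]
  ring

end SpecialWeights

section BaileyPairs

variable {a x q : ℂ}

theorem isBaileyPair_qWeight_div_qPoch (ha : ‖a‖ < 1) (hx : ‖x‖ < 1) (hq : ‖q‖ < 1) :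
    IsBaileyPair a q (fun r => (1 - a * q ^ (2 * r)) * (qWeight x a q r / qPoch x q (r + 1)))
      (fun n => ((1 - x * q ^ n) * (qPoch q q n * qPoch a q n))⁻¹) := by
  have hx₀ := one_sub_ne_zero_of_norm_lt_one hx
  have ha' := one_sub_mul_pow_ne_zero ha hq
  have hq' := one_sub_mul_pow_ne_zero hq hq
  have hx' := one_sub_mul_pow_ne_zero hx hq
  have hxq' : ∀ k, 1 - x * q * q ^ k ≠ 0 := fun k => by
    simpa only [pow_succ', mul_assoc] using hx' (k + 1)
  have h := (isBaileyPair_wellPoised (s := 1) ha' hq' hxq' (by simpa using ha')).const_mul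
    (1 - x)⁻¹
  simp only [mul_one] at h
  convert h using 2 with r n
  · have hqr := qPoch_ne_zero hq' r
    have har := qPoch_ne_zero ha' r
    rw [qPoch_succ', wellPoisedTerm, mul_one, ← qPoch]
    field_simp
  · have hxn := hx' n
    have hpoch := (qPoch_succ x q n).symm.trans (qPoch_succ' x q n)
    have hxqn := qPoch_ne_zero hxq' n
    rw [eq_div_of_mul_eq hxn hpoch]
    field_simp

theorem isBaileyPair_sq (hq : ‖q‖ < 1) :
    IsBaileyPair (q ^ 2) (q ^ 2) (fun r => (-1) ^ r * q ^ (r ^ 2) * (1 + q ^ (2 * r + 1)))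
      (fun n => ((1 - q ^ (2 * n + 1)) *
        (qPoch (q ^ 2) (q ^ 2) n * qPoch (q ^ 2) (q ^ 2) n))⁻¹) := by
  have hq2 := norm_sq_lt_one hq
  convert isBaileyPair_qWeight_div_qPoch hq2 hq hq2 using 2 with r n
  · have hqr := qPoch_ne_zero (one_sub_mul_pow_ne_zero hq hq2) r
    have hqr' := one_sub_mul_pow_ne_zero hq hq2 r
    have hw := qWeight_mul_self_sq 1 q q r
    rw [one_mul, ← sq] at hw
    rw [hw, qPoch_succ]
    field_simp
    ring
  · rw [← pow_mul, pow_succ']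

theorem isBaileyPair_zero (hx : ‖x‖ < 1) (hq : ‖q‖ < 1) :
    IsBaileyPair 0 q (fun r => qWeight x 0 q r / qPoch x q (r + 1))
      (fun n => ((1 - x * q ^ n) * qPoch q q n)⁻¹) := by
  simpa [qPoch_zero_left] using isBaileyPair_qWeight_div_qPoch (norm_zero.trans_lt one_pos) hx hq

theorem prod_zero_sub_sq_mul_pow (q : ℂ) (r : ℕ) :
    ∏ k ∈ range r, (0 - q ^ 2 * (q ^ 2) ^ k) = (-1) ^ r * q ^ (r ^ 2 + r) := by
  induction r with
  | zero => simp
  | succ r ih => rw [prod_range_succ, ih]; ring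

theorem isBaileyPair_falseTheta (hq : ‖q‖ < 1) :
    IsBaileyPair (q ^ 2) (q ^ 2) (fun r => q ^ (2 * r ^ 2 + r) * (1 + q ^ (2 * r + 1)))
      (fun n => (qPoch (q ^ 2) (q ^ 2) n * qPoch q (q ^ 2) (n + 1))⁻¹) := by
  have hq2 := norm_sq_lt_one hq
  have hq₀ := one_sub_ne_zero_of_norm_lt_one hq
  have hq2' := one_sub_mul_pow_ne_zero hq2 hq2
  have hq' : ∀ k, 1 - q * q ^ 2 * (q ^ 2) ^ k ≠ 0 := fun k => by
    simpa only [pow_succ', mul_assoc] using one_sub_mul_pow_ne_zero hq hq2 (k + 1)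
  have h := (isBaileyPair_wellPoised (s := 0) (x := q) hq2' hq2' hq' (by simp)).const_mul
    (1 - q)⁻¹
  convert h using 2 with r n
  · have hne := one_sub_mul_pow_ne_zero hq hq2 r
    have hqr := qPoch_ne_zero (one_sub_mul_pow_ne_zero hq hq2) r
    have hqr2 := qPoch_ne_zero hq2' r
    have hpoch : qPoch (q * q ^ 2) (q ^ 2) r =
        qPoch q (q ^ 2) r * (1 - q * (q ^ 2) ^ r) / (1 - q) := by
      rw [eq_div_iff hq₀, ← qPoch_succ, qPoch_succ', mul_comm]
    have hw := qWeight_mul_self_sq 1 q q r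
    rw [one_mul, ← sq] at hw
    rw [wellPoisedTerm, prod_zero_sub_sq_mul_pow, hw, mul_zero, qPoch_zero_left, hpoch]
    have hsign : ((-1 : ℂ) ^ r) ^ 2 = 1 := by rw [← pow_mul', (even_two_mul r).neg_one_pow]
    field_simp
    linear_combination (-q ^ (2 * r ^ 2 + r) * (1 - q ^ (2 * (2 * r + 1)))) * hsign
  · simp [qPoch_zero_left, qPoch_succ']
    ring

/-- The `α`-sequence of a Bailey pair relative to `q` in base `q`: the part even in `p = q^{1/2}`
of the sequence of `isBaileyPair_sq` in base `p^2`. -/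
noncomputable def evenAlpha (q : ℂ) (r : ℕ) : ℂ := (-1) ^ r * q ^ (2 * ((r + 1) / 2) ^ 2)

/-- The `α`-sequence of a Bailey pair relative to `q` in base `q`: the part odd in `p = q^{1/2}`
of the sequence of `isBaileyPair_sq` in base `p^2`, divided by `p`. -/
noncomputable def oddAlpha (q : ℂ) (r : ℕ) : ℂ := (-1) ^ r * q ^ (2 * (r / 2) ^ 2 + 2 * (r / 2))

theorem evenAlpha_two_mul (q : ℂ) (k : ℕ) : evenAlpha q (2 * k) = q ^ (2 * k ^ 2) := by
  rw [evenAlpha, show (2 * k + 1) / 2 = k by omega, (even_two_mul k).neg_one_pow, one_mul]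

theorem evenAlpha_two_mul_add_one (q : ℂ) (k : ℕ) :
    evenAlpha q (2 * k + 1) = -q ^ (2 * (k + 1) ^ 2) := by
  rw [evenAlpha, show (2 * k + 1 + 1) / 2 = k + 1 by omega, (odd_two_mul_add_one k).neg_one_pow,
    neg_one_mul]

theorem oddAlpha_two_mul (q : ℂ) (k : ℕ) : oddAlpha q (2 * k) = q ^ (2 * k ^ 2 + 2 * k) := by
  rw [oddAlpha, show 2 * k / 2 = k by omega, (even_two_mul k).neg_one_pow, one_mul]

theorem oddAlpha_two_mul_add_one (q : ℂ) (k : ℕ) :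
    oddAlpha q (2 * k + 1) = -q ^ (2 * k ^ 2 + 2 * k) := by
  rw [oddAlpha, show (2 * k + 1) / 2 = k by omega, (odd_two_mul_add_one k).neg_one_pow,
    neg_one_mul]

theorem two_mul_evenAlpha_sq (p : ℂ) (r : ℕ) :
    2 * evenAlpha (p ^ 2) r =
      (-1) ^ r * p ^ (r ^ 2) * (1 + p ^ (2 * r + 1)) + p ^ (r ^ 2) * (1 - p ^ (2 * r + 1)) := by
  obtain ⟨k, rfl | rfl⟩ := Nat.even_or_odd' r
  · rw [evenAlpha_two_mul, (even_two_mul k).neg_one_pow]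
    ring
  · rw [evenAlpha_two_mul_add_one, (odd_two_mul_add_one k).neg_one_pow]
    ring

theorem two_mul_mul_oddAlpha_sq (p : ℂ) (r : ℕ) :
    2 * p * oddAlpha (p ^ 2) r =
      (-1) ^ r * p ^ (r ^ 2) * (1 + p ^ (2 * r + 1)) - p ^ (r ^ 2) * (1 - p ^ (2 * r + 1)) := by
  obtain ⟨k, rfl | rfl⟩ := Nat.even_or_odd' r
  · rw [oddAlpha_two_mul, (even_two_mul k).neg_one_pow]
    ring
  · rw [oddAlpha_two_mul_add_one, (odd_two_mul_add_one k).neg_one_pow]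
    ring

theorem isBaileyPair_sq_neg (hq : ‖q‖ < 1) :
    IsBaileyPair (q ^ 2) (q ^ 2) (fun r => q ^ (r ^ 2) * (1 - q ^ (2 * r + 1)))
      (fun n => ((1 + q ^ (2 * n + 1)) *
        (qPoch (q ^ 2) (q ^ 2) n * qPoch (q ^ 2) (q ^ 2) n))⁻¹) := by
  have hodd : ∀ n, (-q) ^ (2 * n + 1) = -q ^ (2 * n + 1) := fun n =>
    (odd_two_mul_add_one n).neg_pow q
  have hsign : ∀ r : ℕ, (-1 : ℂ) ^ r * (-q) ^ (r ^ 2) = q ^ (r ^ 2) := fun r => by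
    rw [neg_pow q, ← mul_assoc, ← pow_add, (by simp [parity_simps] : Even (r + r ^ 2)).neg_one_pow,
      one_mul]
  have h := isBaileyPair_sq (norm_neg q ▸ hq)
  simpa only [neg_sq, hodd, hsign, sub_neg_eq_add, ← sub_eq_add_neg] using h

theorem exists_sq_eq_of_norm_lt_one (hq : ‖q‖ < 1) : ∃ p : ℂ, ‖p‖ < 1 ∧ p ^ 2 = q := by
  obtain ⟨p, hp⟩ := IsAlgClosed.exists_pow_nat_eq q two_pos
  rw [← hp, norm_pow] at hq
  exact ⟨p, (sq_lt_one_iff₀ (norm_nonneg p)).1 hq, hp⟩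

theorem isBaileyPair_evenAlpha (hq : ‖q‖ < 1) :
    IsBaileyPair q q (evenAlpha q)
      (fun n => ((1 - q ^ (2 * n + 1)) * (qPoch q q n * qPoch q q n))⁻¹) := by
  obtain ⟨p, hp, rfl⟩ := exists_sq_eq_of_norm_lt_one hq
  convert ((isBaileyPair_sq hp).add (isBaileyPair_sq_neg hp)).const_mul (1 / 2) using 2 with r n
  · rw [← two_mul_evenAlpha_sq]
    ring
  · rw [← pow_mul, pow_mul']
    have hsub : 1 - p ^ (2 * n + 1) ≠ 0 := one_sub_pow_ne_zero hp (2 * n).succ_ne_zero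
    have hadd : 1 + p ^ (2 * n + 1) ≠ 0 := one_add_pow_ne_zero hp (2 * n).succ_ne_zero
    rw [show 1 - (p ^ (2 * n + 1)) ^ 2 = (1 - p ^ (2 * n + 1)) * (1 + p ^ (2 * n + 1)) by ring]
    generalize p ^ (2 * n + 1) = x at *
    field_simp
    ring

theorem isBaileyPair_oddAlpha_zero :
    IsBaileyPair 0 0 (oddAlpha 0)
      (fun n => 0 ^ n * ((1 - 0 ^ (2 * n + 1)) * (qPoch 0 0 n * qPoch 0 0 n))⁻¹) := by
  rintro (_ | n)
  · simp [oddAlpha, baileyKernel, qPoch_zero_left]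
  · rw [sum_range_succ', sum_range_succ']
    simp [oddAlpha, baileyKernel, qPoch_zero_left]

theorem isBaileyPair_oddAlpha (hq : ‖q‖ < 1) :
    IsBaileyPair q q (oddAlpha q)
      (fun n => q ^ n * ((1 - q ^ (2 * n + 1)) * (qPoch q q n * qPoch q q n))⁻¹) := by
  rcases eq_or_ne q 0 with rfl | hq₀
  · exact isBaileyPair_oddAlpha_zero
  obtain ⟨p, hp, rfl⟩ := exists_sq_eq_of_norm_lt_one hq
  have hp₀ : p ≠ 0 := by simpa using hq₀
  convert ((isBaileyPair_sq hp).add ((isBaileyPair_sq_neg hp).const_mul (-1))).const_mul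
    (2 * p)⁻¹ using 2 with r n
  · rw [neg_one_mul, ← sub_eq_add_neg, ← two_mul_mul_oddAlpha_sq]
    field_simp
  · rw [← pow_mul, ← pow_mul, pow_mul' p 2 (2 * n + 1)]
    have hsub : 1 - p ^ (2 * n + 1) ≠ 0 := one_sub_pow_ne_zero hp (2 * n).succ_ne_zero
    have hadd : 1 + p ^ (2 * n + 1) ≠ 0 := one_add_pow_ne_zero hp (2 * n).succ_ne_zero
    have hx : p ^ (2 * n) * p = p ^ (2 * n + 1) := (pow_succ _ _).symm
    rw [show 1 - (p ^ (2 * n + 1)) ^ 2 = (1 - p ^ (2 * n + 1)) * (1 + p ^ (2 * n + 1)) by ring]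
    rw [eq_div_of_mul_eq hp₀ hx]
    generalize p ^ (2 * n + 1) = x at *
    field_simp
    ring

end BaileyPairs

section Identities

variable {q : ℂ}

theorem IsBaileyPair.hasSum_mul_qPoch_pairs {a : ℂ} {α β : ℕ → ℂ} (h : IsBaileyPair a q α β)
    (ha : ‖a‖ < 1) (hq : ‖q‖ < 1) {M : ℝ} (hα : ∀ r, ‖α r‖ ≤ M) {y : ℂ} (hy : ‖y‖ < 1)
    {v : ℕ → ℂ} (hv : ∀ n, qWeight y (a * q) q n = v n * qPoch y q n) {g : ℕ → ℂ}
    (hg : ∀ k, g k = α (2 * k) * v (2 * k) + α (2 * k + 1) * v (2 * k + 1)) :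
    Summable g ∧
      HasSum (fun n => v n * qPoch y q n * β n) (qPochInf y q / qPochInf a q * ∑' k, g k) := by
  obtain ⟨hsum, h⟩ := h.hasSum_mul_qPoch ha hq hα hy hv
  have hpairs := hasSum_of_eq_of_eq (hasSum_pairs hsum.hasSum) hg rfl
  rw [← hpairs.tsum_eq] at h
  exact ⟨hpairs.summable, h⟩

theorem hasSum_sq_add_self_div_qPoch_sq (hq : ‖q‖ < 1) :
    Summable (fun r : ℕ => q ^ (6 * r ^ 2 + 2 * r) * (1 - q ^ (8 * r + 4))) ∧
      HasSum (fun n : ℕ => q ^ (n ^ 2 + n) / ((1 - q ^ (2 * n + 1)) * (qPoch q q n * qPoch q q n)))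
        ((∑' r : ℕ, q ^ (6 * r ^ 2 + 2 * r) * (1 - q ^ (8 * r + 4))) / qPochInf q q) := by
  obtain ⟨hsum, h⟩ := (isBaileyPair_evenAlpha hq).hasSum_mul_qPoch_pairs hq hq
    (fun _ => norm_neg_one_pow_mul_pow_le_one hq _ _) (norm_zero.trans_lt one_pos)
    (v := fun n => q ^ (n ^ 2 + n))
    (g := fun r => q ^ (6 * r ^ 2 + 2 * r) * (1 - q ^ (8 * r + 4)))
    (fun n => by rw [qWeight_zero_mul_self, qPoch_zero_left, mul_one])
    fun k => by rw [evenAlpha_two_mul, evenAlpha_two_mul_add_one]; ring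
  refine ⟨hsum, hasSum_of_eq_of_eq h (fun n => ?_) ?_⟩
  · rw [qPoch_zero_left, mul_one, div_eq_mul_inv]
  · rw [qPochInf_zero_left, one_div_mul_eq_div]

theorem hasSum_sq_add_two_mul_div_qPoch_sq (hq : ‖q‖ < 1) :
    Summable (fun r : ℕ => q ^ (6 * r ^ 2 + 4 * r) * (1 - q ^ (4 * r + 2))) ∧
      HasSum (fun n : ℕ =>
          q ^ (n ^ 2 + 2 * n) / ((1 - q ^ (2 * n + 1)) * (qPoch q q n * qPoch q q n)))
        ((∑' r : ℕ, q ^ (6 * r ^ 2 + 4 * r) * (1 - q ^ (4 * r + 2))) / qPochInf q q) := by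
  obtain ⟨hsum, h⟩ := (isBaileyPair_oddAlpha hq).hasSum_mul_qPoch_pairs hq hq
    (fun _ => norm_neg_one_pow_mul_pow_le_one hq _ _) (norm_zero.trans_lt one_pos)
    (v := fun n => q ^ (n ^ 2 + n))
    (g := fun r => q ^ (6 * r ^ 2 + 4 * r) * (1 - q ^ (4 * r + 2)))
    (fun n => by rw [qWeight_zero_mul_self, qPoch_zero_left, mul_one])
    fun k => by rw [oddAlpha_two_mul, oddAlpha_two_mul_add_one]; ring
  refine ⟨hsum, hasSum_of_eq_of_eq h (fun n => ?_) ?_⟩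
  · rw [qPoch_zero_left, div_eq_mul_inv]
    ring
  · rw [qPochInf_zero_left, one_div_mul_eq_div]

theorem hasSum_half_sq_add_self_div_qPoch_sq (hq : ‖q‖ < 1) :
    Summable (fun r : ℕ => q ^ (4 * r ^ 2 + r) * (1 - q ^ (6 * r + 3))) ∧
      HasSum (fun n : ℕ => qPoch (-q) q n * q ^ ((n ^ 2 + n) / 2) /
          ((1 - q ^ (2 * n + 1)) * (qPoch q q n * qPoch q q n)))
        (qPochInf (-q) q / qPochInf q q *
          ∑' r : ℕ, q ^ (4 * r ^ 2 + r) * (1 - q ^ (6 * r + 3))) := by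
  obtain ⟨hsum, h⟩ := (isBaileyPair_evenAlpha hq).hasSum_mul_qPoch_pairs hq hq
    (fun _ => norm_neg_one_pow_mul_pow_le_one hq _ _) (norm_neg q ▸ hq) (qWeight_neg_self q)
    (g := fun r => q ^ (4 * r ^ 2 + r) * (1 - q ^ (6 * r + 3)))
    fun k => by
      rw [evenAlpha_two_mul, evenAlpha_two_mul_add_one, half_two_mul_sq_add,
        half_two_mul_add_one_sq_add]
      ring
  refine ⟨hsum, hasSum_of_eq_of_eq h (fun n => ?_) rfl⟩
  rw [div_eq_mul_inv, mul_comm (qPoch (-q) q n)]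

theorem hasSum_half_sq_add_three_mul_div_qPoch_sq (hq : ‖q‖ < 1) :
    Summable (fun r : ℕ => q ^ (4 * r ^ 2 + 3 * r) * (1 - q ^ (2 * r + 1))) ∧
      HasSum (fun n : ℕ => qPoch (-q) q n * q ^ ((n ^ 2 + 3 * n) / 2) /
          ((1 - q ^ (2 * n + 1)) * (qPoch q q n * qPoch q q n)))
        (qPochInf (-q) q / qPochInf q q *
          ∑' r : ℕ, q ^ (4 * r ^ 2 + 3 * r) * (1 - q ^ (2 * r + 1))) := by
  obtain ⟨hsum, h⟩ := (isBaileyPair_oddAlpha hq).hasSum_mul_qPoch_pairs hq hq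
    (fun _ => norm_neg_one_pow_mul_pow_le_one hq _ _) (norm_neg q ▸ hq) (qWeight_neg_self q)
    (g := fun r => q ^ (4 * r ^ 2 + 3 * r) * (1 - q ^ (2 * r + 1)))
    fun k => by
      rw [oddAlpha_two_mul, oddAlpha_two_mul_add_one, half_two_mul_sq_add,
        half_two_mul_add_one_sq_add]
      ring
  refine ⟨hsum, hasSum_of_eq_of_eq h (fun n => ?_) rfl⟩
  rw [show (n ^ 2 + 3 * n) / 2 = (n ^ 2 + n) / 2 + n by omega, pow_add]
  ring

theorem isBaileyPair_sq_contiguous_term (hq : ‖q‖ < 1) (r : ℕ) :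
    (-1) ^ r * q ^ (r ^ 2) * (1 + q ^ (2 * r + 1)) * (qWeight (-q) (q ^ 2) (q ^ 2) r *
        ((1 + q ^ 2 * (q ^ 2) ^ (2 * r) - -q * (q ^ 2) ^ r) *
          qPochInf (-q * (q ^ 2) ^ (r + 1)) (q ^ 2))) =
      (-1) ^ r * q ^ (2 * r ^ 2) * (1 + q ^ (2 * r + 1) + q ^ (4 * r + 2)) *
        qPochInf (-q) (q ^ 2) := by
  rw [qWeight_neg_self_sq, qPochInf_eq_qPoch_mul (-q) (norm_sq_lt_one hq) (r + 1), qPoch_succ]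
  ring

theorem hasSum_neg_one_pow_mul_sq (hq : ‖q‖ < 1) :
    Summable (fun r : ℕ => q ^ (8 * r ^ 2 + 4 * r + 1) * (1 - q ^ (8 * r + 4))) ∧
      HasSum (fun r : ℕ => (-1) ^ r * q ^ (2 * r ^ 2) * (1 + q ^ (2 * r + 1) + q ^ (4 * r + 2)))
        (1 + ∑' r : ℕ, q ^ (8 * r ^ 2 + 4 * r + 1) * (1 - q ^ (8 * r + 4))) := by
  have hf : Summable fun r : ℕ => (-1) ^ r * q ^ (2 * r ^ 2) := .of_norm <| by
    simpa [norm_mul] using (summable_pow_of_le hq fun r => by nlinarith).norm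
  have hg : Summable fun r : ℕ => (-1) ^ r * q ^ (2 * r ^ 2 + 2 * r + 1) := .of_norm <| by
    simpa [norm_mul] using
      (summable_pow_of_le hq (f := fun r => 2 * r ^ 2 + 2 * r + 1) fun r => by nlinarith).norm
  have hpairs : HasSum (fun r : ℕ => q ^ (8 * r ^ 2 + 4 * r + 1) * (1 - q ^ (8 * r + 4)))
      (∑' r : ℕ, (-1) ^ r * q ^ (2 * r ^ 2 + 2 * r + 1)) := by
    refine hasSum_of_eq_of_eq (hasSum_pairs hg.hasSum) (fun k => ?_) rfl
    rw [(even_two_mul k).neg_one_pow, (odd_two_mul_add_one k).neg_one_pow]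
    ring
  refine ⟨hpairs.summable, ?_⟩
  refine hasSum_of_eq_of_eq ((hasSum_sub_nat_add hf 1).add hg.hasSum) (fun r => by ring) ?_
  simp [hpairs.tsum_eq]

theorem hasSum_sq_mul_qPoch_neg_div_qPoch_sq (hq : ‖q‖ < 1) :
    Summable (fun r : ℕ => q ^ (8 * r ^ 2 + 4 * r + 1) * (1 - q ^ (8 * r + 4))) ∧
      HasSum (fun n : ℕ => qPoch (-q) (q ^ 2) n * q ^ (n ^ 2) /
          ((1 - q ^ (2 * n + 1)) * (qPoch (q ^ 2) (q ^ 2) n * qPoch (q ^ 2) (q ^ 2) n)))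
        (qPochInf (-q) (q ^ 2) / qPochInf (q ^ 2) (q ^ 2) *
          (1 + ∑' r : ℕ, q ^ (8 * r ^ 2 + 4 * r + 1) * (1 - q ^ (8 * r + 4)))) := by
  have hq2 := norm_sq_lt_one hq
  obtain ⟨hsum, htheta⟩ := hasSum_neg_one_pow_mul_sq hq
  have hα : ∀ r : ℕ, ‖(-1) ^ r * q ^ (r ^ 2) * (1 + q ^ (2 * r + 1))‖ ≤ 1 * 2 := fun r => by
    rw [norm_mul]
    gcongr
    exacts [norm_neg_one_pow_mul_pow_le_one hq r _, norm_one_add_pow_le_two hq _]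
  have h := (isBaileyPair_sq hq).hasSum_qWeight_contiguous hq2 hq2 hα (-q)
  simp only [isBaileyPair_sq_contiguous_term hq, tsum_mul_right, htheta.tsum_eq] at h
  refine ⟨hsum, hasSum_of_eq_of_eq h (fun n => ?_) (by ring)⟩
  rw [qWeight_neg_self_sq]
  ring

theorem hasSum_zpow_sub_pow (hq : ‖q‖ < 1) (hq₀ : q ≠ 0) :
    HasSum (fun r : ℕ => q ^ (r ^ 2) * (q ^ (-(2 * r : ℤ)) - q ^ (2 * r))) (1 + q⁻¹) := by
  have hshift : ∀ r : ℕ, q ^ ((r + 2) ^ 2) * q ^ (-(2 * (r + 2 : ℕ) : ℤ)) =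
      q ^ (r ^ 2) * q ^ (2 * r) := fun r => by
    rw [← pow_add, ← zpow_natCast, ← zpow_natCast, ← zpow_add₀ hq₀]
    congr 1
    push_cast
    ring
  have hf : Summable fun r : ℕ => q ^ (r ^ 2) * q ^ (-(2 * r : ℤ)) := by
    rw [← summable_nat_add_iff 2]
    simp only [hshift, ← pow_add]
    exact summable_pow_of_le hq fun r => by nlinarith
  refine hasSum_of_eq_of_eq (hasSum_sub_nat_add hf 2) (fun r => by rw [hshift, mul_sub]) ?_
  have hone : q * (q ^ 2)⁻¹ = q⁻¹ := by field_simp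
  simp [sum_range_succ, ← hone]

theorem hasSum_qPoch_neg_mul_zpow (hq : ‖q‖ < 1) (hq₀ : q ≠ 0) :
    HasSum (fun n : ℕ => qPoch (-q) (q ^ 2) (n + 1) * q ^ ((n : ℤ) ^ 2 - 2 * n) /
        (qPoch (q ^ 2) (q ^ 2) n * qPoch (q ^ 2) (q ^ 2) (n + 1)))
      (qPochInf (-q) (q ^ 2) / qPochInf (q ^ 2) (q ^ 2) *
        (1 + q + q ^ 2 + q ^ 3 + (1 + q⁻¹))) := by
  have hq2 := norm_sq_lt_one hq
  have h := (hasSum_qWeight_mul_baileyKernel_contiguous (-q⁻¹) hq2 hq2 0).mul_left (1 + q)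
  refine hasSum_of_eq_of_eq h (fun n => ?_) ?_
  · have hw := qWeight_mul_self_sq (-(q ^ 2)⁻¹) (-q * q ^ 2) q n
    rw [show -(q ^ 2)⁻¹ * q = -q⁻¹ by field_simp, show -q⁻¹ * (-q * q ^ 2) = q ^ 2 by field_simp,
      neg_neg] at hw
    have hpow : q ^ ((n : ℤ) ^ 2 - 2 * n) = (q ^ 2)⁻¹ ^ n * q ^ (n ^ 2) := by
      rw [zpow_sub₀ hq₀, zpow_mul]
      norm_cast
      rw [inv_pow]
      ring
    rw [hw, hpow, qPoch_succ' (-q), baileyKernel, if_pos n.zero_le, Nat.sub_zero, add_zero,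
      sub_neg_eq_add]
    ring
  · rw [qWeight_zero, show -q⁻¹ * (q ^ 2) ^ (0 + 1) = -q by field_simp; ring]
    field_simp
    ring

theorem hasSum_sq_sub_two_mul_div_qPoch_mul_qPoch_succ (hq : ‖q‖ < 1) (hq₀ : q ≠ 0) :
    Summable (fun r : ℕ => q ^ (r ^ 2) * (q ^ (-(2 * r : ℤ)) - q ^ (2 * r))) ∧
      HasSum (fun n : ℕ => qPoch (-q) (q ^ 2) (n + 1) * q ^ ((n : ℤ) ^ 2 - 2 * n) /
          (qPoch (q ^ 2) (q ^ 2) n * qPoch (q ^ 2) (q ^ 2) (n + 1)))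
        (qPochInf (-q) (q ^ 2) / qPochInf (q ^ 2) (q ^ 2) *
          (1 + q + q ^ 2 + q ^ 3 +
            ∑' r : ℕ, q ^ (r ^ 2) * (q ^ (-(2 * r : ℤ)) - q ^ (2 * r)))) := by
  have htheta := hasSum_zpow_sub_pow hq hq₀
  exact ⟨htheta.summable, htheta.tsum_eq ▸ hasSum_qPoch_neg_mul_zpow hq hq₀⟩

theorem hasSum_falseTheta (hq : ‖q‖ < 1) :
    Summable (fun r : ℕ => (-1) ^ r * q ^ (3 * r ^ 2 + 2 * r) * (1 + q ^ (2 * r + 1))) ∧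
      HasSum (fun n : ℕ => (-1) ^ n * q ^ (n ^ 2 + n) / qPoch q (q ^ 2) (n + 1))
        (∑' r : ℕ, (-1) ^ r * q ^ (3 * r ^ 2 + 2 * r) * (1 + q ^ (2 * r + 1))) := by
  have hq2 := norm_sq_lt_one hq
  have hα : ∀ r : ℕ, ‖q ^ (2 * r ^ 2 + r) * (1 + q ^ (2 * r + 1))‖ ≤ 1 * 2 := fun r => by
    rw [norm_mul]
    gcongr
    exacts [norm_pow_le_one hq _, norm_one_add_pow_le_two hq _]
  obtain ⟨hsum, h⟩ := (isBaileyPair_falseTheta hq).hasSum_mul_qPoch hq2 hq2 hα hq2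
    (v := fun n => (-1) ^ n * q ^ (n ^ 2 + n)) fun n => by
      have hw := qWeight_mul_self_sq q (q ^ 2) q n
      rw [← sq] at hw
      rw [hw, neg_pow]
      ring
  have hterm : ∀ r : ℕ, q ^ (2 * r ^ 2 + r) * (1 + q ^ (2 * r + 1)) *
      ((-1) ^ r * q ^ (r ^ 2 + r)) =
      (-1) ^ r * q ^ (3 * r ^ 2 + 2 * r) * (1 + q ^ (2 * r + 1)) := fun r => by ring
  simp only [hterm] at hsum h
  refine ⟨hsum, hasSum_of_eq_of_eq h (fun n => ?_) ?_⟩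
  · have hn := qPoch_ne_zero (one_sub_mul_pow_ne_zero hq2 hq2) n
    rw [mul_inv, mul_assoc, mul_inv_cancel_left₀ hn, div_eq_mul_inv]
  · rw [div_self (qPochInf_ne_zero hq2 hq2), one_mul]

theorem hasSum_sq_add_two_mul_div_qPoch_eq_tsum (hq : ‖q‖ < 1) :
    HasSum (fun n : ℕ => q ^ (n ^ 2 + 2 * n) / ((1 - q ^ (2 * n + 1)) * qPoch (q ^ 2) (q ^ 2) n))
      (qPochInf (-q) (q ^ 2) *
        ∑' r : ℕ, (-1) ^ r * (q ^ 2) ^ (r ^ 2 + r) / qPoch (q ^ 2) ((q ^ 2) ^ 2) (r + 1)) := by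
  have hq2 := norm_sq_lt_one hq
  obtain ⟨C, hC⟩ := exists_norm_inv_qPoch_le hq hq2
  have hα : ∀ r, ‖qWeight q 0 (q ^ 2) r / qPoch q (q ^ 2) (r + 1)‖ ≤ 1 * C := fun r => by
    rw [div_eq_mul_inv, norm_mul, qWeight_self_zero_sq]
    gcongr
    exacts [norm_neg_one_pow_mul_pow_le_one hq _ _, hC _]
  have h := ((isBaileyPair_zero hq hq2).hasSum_qWeight (norm_zero.trans_lt one_pos) hq2 hα
    (-q * q ^ 2)).2
  rw [zero_mul, qPochInf_zero_left, div_one] at h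
  refine hasSum_of_eq_of_eq h (fun n => ?_) ?_
  · rw [qWeight_neg_mul_sq_zero, ← pow_mul, ← pow_succ', div_eq_mul_inv]
  · rw [← tsum_mul_left]
    refine tsum_congr fun r => ?_
    have hr := qPoch_ne_zero (one_sub_mul_pow_ne_zero (norm_neg q ▸ hq) hq2) (r + 1)
    rw [qWeight_self_zero_sq, qWeight_neg_mul_sq_zero, qPochInf_eq_qPoch_mul (-q) hq2 (r + 1),
      ← qPoch_mul_qPoch_neg, pow_succ' _ r, mul_assoc (-q)]
    field_simp
    ring

theorem hasSum_sq_add_two_mul_div_qPoch (hq : ‖q‖ < 1) :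
    Summable (fun r : ℕ => (-1) ^ r * q ^ (6 * r ^ 2 + 4 * r) * (1 + q ^ (4 * r + 2))) ∧
      HasSum (fun n : ℕ => q ^ (n ^ 2 + 2 * n) /
          ((1 - q ^ (2 * n + 1)) * qPoch (q ^ 2) (q ^ 2) n))
        (qPochInf (-q) (q ^ 2) *
          ∑' r : ℕ, (-1) ^ r * q ^ (6 * r ^ 2 + 4 * r) * (1 + q ^ (4 * r + 2))) := by
  obtain ⟨hsum, htheta⟩ := hasSum_falseTheta (norm_sq_lt_one hq)
  have hexp : ∀ r : ℕ, (-1) ^ r * (q ^ 2) ^ (3 * r ^ 2 + 2 * r) * (1 + (q ^ 2) ^ (2 * r + 1)) =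
      (-1) ^ r * q ^ (6 * r ^ 2 + 4 * r) * (1 + q ^ (4 * r + 2)) := fun r => by ring
  simp only [hexp] at hsum htheta
  exact ⟨hsum, htheta.tsum_eq ▸ hasSum_sq_add_two_mul_div_qPoch_eq_tsum hq⟩

end Identities

theorem corollary3p10 (q : ℂ) (hq : ‖q‖ < 1) :
    -- first identity
    (Summable (fun r : ℕ => q ^ (8 * r ^ 2 + 4 * r + 1) * (1 - q ^ (8 * r + 4))) ∧
      HasSum
        (fun n : ℕ => qPoch (-q) (q ^ 2) n * q ^ (n ^ 2) /
          ((1 - q ^ (2 * n + 1)) * (qPoch (q ^ 2) (q ^ 2) n * qPoch (q ^ 2) (q ^ 2) n)))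
        (qPochInf (-q) (q ^ 2) / qPochInf (q ^ 2) (q ^ 2) *
          (1 + ∑' r : ℕ, q ^ (8 * r ^ 2 + 4 * r + 1) * (1 - q ^ (8 * r + 4))))) ∧
    -- second identity
    (Summable (fun r : ℕ => q ^ (6 * r ^ 2 + 2 * r) * (1 - q ^ (8 * r + 4))) ∧
      HasSum
        (fun n : ℕ => q ^ (n ^ 2 + n) /
          ((1 - q ^ (2 * n + 1)) * (qPoch q q n * qPoch q q n)))
        ((∑' r : ℕ, q ^ (6 * r ^ 2 + 2 * r) * (1 - q ^ (8 * r + 4))) / qPochInf q q)) ∧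
    -- third identity
    (Summable (fun r : ℕ => q ^ (6 * r ^ 2 + 4 * r) * (1 - q ^ (4 * r + 2))) ∧
      HasSum
        (fun n : ℕ => q ^ (n ^ 2 + 2 * n) /
          ((1 - q ^ (2 * n + 1)) * (qPoch q q n * qPoch q q n)))
        ((∑' r : ℕ, q ^ (6 * r ^ 2 + 4 * r) * (1 - q ^ (4 * r + 2))) / qPochInf q q)) ∧
    -- fourth identity (the division by 2 in the exponent is exact)
    (Summable (fun r : ℕ => q ^ (4 * r ^ 2 + r) * (1 - q ^ (6 * r + 3))) ∧
      HasSum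
        (fun n : ℕ => qPoch (-q) q n * q ^ ((n ^ 2 + n) / 2) /
          ((1 - q ^ (2 * n + 1)) * (qPoch q q n * qPoch q q n)))
        (qPochInf (-q) q / qPochInf q q *
          ∑' r : ℕ, q ^ (4 * r ^ 2 + r) * (1 - q ^ (6 * r + 3)))) ∧
    -- fifth identity (the division by 2 in the exponent is exact)
    (Summable (fun r : ℕ => q ^ (4 * r ^ 2 + 3 * r) * (1 - q ^ (2 * r + 1))) ∧
      HasSum
        (fun n : ℕ => qPoch (-q) q n * q ^ ((n ^ 2 + 3 * n) / 2) /
          ((1 - q ^ (2 * n + 1)) * (qPoch q q n * qPoch q q n)))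
        (qPochInf (-q) q / qPochInf q q *
          ∑' r : ℕ, q ^ (4 * r ^ 2 + 3 * r) * (1 - q ^ (2 * r + 1)))) ∧
    -- sixth identity
    (Summable (fun r : ℕ => (-1) ^ r * q ^ (6 * r ^ 2 + 4 * r) * (1 + q ^ (4 * r + 2))) ∧
      HasSum
        (fun n : ℕ => q ^ (n ^ 2 + 2 * n) /
          ((1 - q ^ (2 * n + 1)) * qPoch (q ^ 2) (q ^ 2) n))
        (qPochInf (-q) (q ^ 2) *
          ∑' r : ℕ, (-1) ^ r * q ^ (6 * r ^ 2 + 4 * r) * (1 + q ^ (4 * r + 2)))) ∧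
    -- seventh identity, which involves negative powers of `q`
    (q ≠ 0 →
      Summable (fun r : ℕ => q ^ (r ^ 2) * (q ^ (-(2 * r : ℤ)) - q ^ (2 * r))) ∧
      HasSum
        (fun n : ℕ => qPoch (-q) (q ^ 2) (n + 1) * q ^ ((n : ℤ) ^ 2 - 2 * n) /
          (qPoch (q ^ 2) (q ^ 2) n * qPoch (q ^ 2) (q ^ 2) (n + 1)))
        (qPochInf (-q) (q ^ 2) / qPochInf (q ^ 2) (q ^ 2) *
          (1 + q + q ^ 2 + q ^ 3 +
            ∑' r : ℕ, q ^ (r ^ 2) * (q ^ (-(2 * r : ℤ)) - q ^ (2 * r))))) :=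
  ⟨hasSum_sq_mul_qPoch_neg_div_qPoch_sq hq, hasSum_sq_add_self_div_qPoch_sq hq,
    hasSum_sq_add_two_mul_div_qPoch_sq hq, hasSum_half_sq_add_self_div_qPoch_sq hq,
    hasSum_half_sq_add_three_mul_div_qPoch_sq hq, hasSum_sq_add_two_mul_div_qPoch hq,
    hasSum_sq_sub_two_mul_div_qPoch_mul_qPoch_succ hq⟩
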